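/- Let $p\ge 1$ and $N\ge 1$ be integers. For $\tau\in\mathbb C$ with $\operatorname{Im}\tau>0$ and $r\in\mathbb R$ write $q^r=e^{2\pi i r\tau}$, and let $\eta(\tau)=q^{1/24}\prod_{n\ge 1}(1-q^n)$ be the Dedekind eta function. Put $$A=\begin{pmatrix}2p+1&2\\2&3\end{pmatrix},\quad B(\boldsymbol x,\boldsymbol y)=\boldsymbol x^{T}A\boldsymbol y,\quad Q(\boldsymbol x)=\tfrac12B(\boldsymbol x,\boldsymbol x),\quad \boldsymbol{c_1}=\frac{1}{\sqrt{3(6p-1)}}\begin{pmatrix}3\\-2\end{pmatrix},$$ and for $\boldsymbol\mu\in\mathbb R^2$ $$\widetilde\theta^{(2)}_{\boldsymbol\mu,\boldsymbol{c_1}}(\tau)=\sum_{\boldsymbol n\in 2\mathbb Z^2+\boldsymbol\mu}\operatorname{sgn}\bigl(B(\boldsymbol n,\boldsymbol{c_1})\bigr)\,q^{Q(\boldsymbol n)},\qquad \operatorname{sgn}(0)=0.$$ For $k=1,\dots,5$ let $\boldsymbol{\mu_k}=\frac12A^{-1}\boldsymbol{m_k}$, where $\boldsymbol{m_1},\dots,\boldsymbol{m_5}$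 are respectively $$\begin{pmatrix}2p+1\\5\end{pmatrix},\ \begin{pmatrix}1\\1\end{pmatrix},\ \begin{pmatrix}2p+3\\3\end{pmatrix},\ \begin{pmatrix}2p+1\\1\end{pmatrix},\ \begin{pmatrix}1\\3\end{pmatrix},$$ and let $(e_k)_{1\le k\le 5}=\bigl((6p+5)^2,\,1,\,36p^2+84p+1,\,(6p+1)^2,\,48p+1\bigr)$ and $(\ell_k)_{1\le k\le5}=(1,\,p,\,2p-1,\,2p,\,3p-1)$. For pairwise coprime positive integers $\boldsymbol p=(p_1,p_2,p_3)$ with $P=p_1p_2p_3$, and integers $\boldsymbol\ell=(\ell_1,\ell_2,\ell_3)$ with $0<\ell_j<p_j$, let $\chi_{\boldsymbol p}^{\boldsymbol\ell}(n)=-\varepsilon_1\varepsilon_2\varepsilon_3$ if $n\equiv P\bigl(1+\sum_{j=1}^3\varepsilon_j\ell_j/p_j\bigr)\pmod{2P}$ for some (necessarily unique) $\boldsymbol\varepsilon\in\{\pm1\}^3$, let $\chi_{\boldsymbol p}^{\boldsymbol\ell}(n)=0$ otherwise, and put $$\widetilde\Phi_{\boldsymbol p}^{\boldsymbol\ell}(\tau)=\sum_{n=0}^{\infty}\chi_{\boldsymbol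 p}^{\boldsymbol\ell}(n)\,q^{\frac{n^2}{4P}}.$$ Then for every $k\in\{1,\dots,5\}$, along the vertical line $\tau=\frac1N+it$, $t\to0^+$, both limits below exist in $\mathbb C$, and $$\lim_{\tau\to1/N}\frac{q^{-\frac{e_k}{24(6p-1)}}}{2\eta(\tau)}\sum_{(\varepsilon_1,\varepsilon_2)\in\{0,1\}^2}(-1)^{\varepsilon_1+\varepsilon_2}\,\widetilde\theta^{(2)}_{\boldsymbol{\mu_k}+\boldsymbol\varepsilon,\boldsymbol{c_1}}(\tau)=-\frac12\lim_{\tau\to1/N}q^{-\frac{e_k}{24(6p-1)}}\,\widetilde\Phi_{(2,3,6p-1)}^{(1,1,\ell_k)}(\tau).$$ -/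

import Mathlib

open scoped Matrix

namespace FalseTheta

noncomputable section

/-- `q ^ r = exp (2 π i r τ)` for a real exponent `r`, where `q = exp (2 π i τ)`. -/
def qPow (r : ℝ) (τ : ℂ) : ℂ := Complex.exp (2 * Real.pi * Complex.I * r * τ)

/-- The bilinear form `B(x, y) = xᵀ A y` on `ℝ²`. -/
def bilin (A : Matrix (Fin 2) (Fin 2) ℝ) (x y : Fin 2 → ℝ) : ℝ := x ⬝ᵥ A *ᵥ y

/-- The quadratic form `Q(x) = B(x, x) / 2`. -/
def quad (A : Matrix (Fin 2) (Fin 2) ℝ) (x : Fin 2 → ℝ) : ℝ := bilin A x x / 2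

/-- The false theta function of the lattice `L = 2ℤ²` and the form given by `A`,
`∑ sgn (B(x, c)) q ^ Q(x)`, the sum running over `x ∈ L + μ`.
A point of `L + μ` is written uniquely as `2 n + μ` with `n ∈ ℤ²`; `Real.sign 0 = 0`. -/
def falseTheta2 (A : Matrix (Fin 2) (Fin 2) ℝ) (μ c : Fin 2 → ℝ) (τ : ℂ) : ℂ :=
  ∑' n : Fin 2 → ℤ,
    ((Real.sign (bilin A (fun i => 2 * (n i : ℝ) + μ i) c) : ℝ) : ℂ) *
      qPow (quad A (fun i => 2 * (n i : ℝ) + μ i)) τ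

/-- The matrix `A = (2p+1, 2; 2, 3)`. -/
def matA (p : ℕ) : Matrix (Fin 2) (Fin 2) ℝ := !![2 * (p : ℝ) + 1, 2; 2, 3]

/-- The vector `c₁ = (3, -2) / √(3(6p-1))`, for which `2 Q(c₁) = 1`. -/
def vecC1 (p : ℕ) : Fin 2 → ℝ := (1 / Real.sqrt (3 * (6 * (p : ℝ) - 1))) • ![3, -2]

/-- The vectors `(m₁, m₂)` of the five families (index `k - 1` for the `k`-th family). -/
def vecM (p : ℕ) : Fin 5 → Fin 2 → ℝ :=
  ![![2 * (p : ℝ) + 1, 5], ![1, 1], ![2 * (p : ℝ) + 3, 3], ![2 * (p : ℝ) + 1, 1], ![1, 3]]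

/-- The vectors `μ_k = A⁻¹ (m₁, m₂)ᵀ / 2` of the five families. -/
def vecMu (p : ℕ) (k : Fin 5) : Fin 2 → ℝ := (1 / 2 : ℝ) • ((matA p)⁻¹ *ᵥ vecM p k)

/-- The integers `e_k` of the five families. -/
def expE (p : ℕ) : Fin 5 → ℤ :=
  ![(6 * (p : ℤ) + 5) ^ 2, 1, 36 * (p : ℤ) ^ 2 + 84 * (p : ℤ) + 1, (6 * (p : ℤ) + 1) ^ 2,
    48 * (p : ℤ) + 1]

/-- The integers `ℓ_k` of the five families. -/
def ell (p : ℕ) : Fin 5 → ℤ :=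
  ![1, (p : ℤ), 2 * (p : ℤ) - 1, 2 * (p : ℤ), 3 * (p : ℤ) - 1]

/-- The integer `P (1 + ∑ j, ε j * ℓ j / p j)` with `P = p 0 * p 1 * p 2`, denominators cleared. -/
def residue (p ℓ : Fin 3 → ℤ) (ε : Fin 3 → ℤˣ) : ℤ :=
  p 0 * p 1 * p 2 + (ε 0 : ℤ) * ℓ 0 * (p 1 * p 2) + (ε 1 : ℤ) * ℓ 1 * (p 0 * p 2) +
    (ε 2 : ℤ) * ℓ 2 * (p 0 * p 1)

/-- The periodic function `χ`: its value at `n` is `- ε 0 * ε 1 * ε 2` if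
`n ≡ P (1 + ∑ j, ε j * ℓ j / p j) mod 2P` for some `ε ∈ {±1}³`, and `0` if there is no such `ε`.
There is at most one such `ε` for pairwise coprime `p j` and `0 < ℓ j < p j`
(see `chi_eq_of_modEq` and `chi_eq_zero`), so it can be written as a sum over `ε`. -/
def chi (p ℓ : Fin 3 → ℤ) (n : ℤ) : ℤ :=
  ∑ ε : Fin 3 → ℤˣ,
    if n ≡ residue p ℓ ε [ZMOD 2 * (p 0 * p 1 * p 2)] then
      -((ε 0 : ℤ) * (ε 1 : ℤ) * (ε 2 : ℤ)) else 0

theorem chi_eq_zero (p ℓ : Fin 3 → ℤ) (n : ℤ)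
    (h : ∀ ε : Fin 3 → ℤˣ, ¬ n ≡ residue p ℓ ε [ZMOD 2 * (p 0 * p 1 * p 2)]) :
    chi p ℓ n = 0 :=
  Finset.sum_eq_zero fun ε _ => if_neg (h ε)

theorem sign_eq_of_dvd {a b l : ℤ} {u v : ℤˣ} (hl : 0 < l) (hla : l < a)
    (hab : IsCoprime a b) (h : 2 * a ∣ ((u : ℤ) - (v : ℤ)) * (l * b)) : u = v := by
  by_contra hne
  have hd : a ∣ l * b := by
    obtain ⟨m, hm⟩ := h
    rcases Int.units_eq_one_or u with rfl | rfl <;> rcases Int.units_eq_one_or v with rfl | rfl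
    · exact absurd rfl hne
    · exact ⟨m, by push_cast at hm; linarith⟩
    · exact ⟨-m, by push_cast at hm; linarith⟩
    · exact absurd rfl hne
  exact absurd (Int.le_of_dvd hl (hab.dvd_of_dvd_mul_right hd)) (not_le.mpr hla)

theorem two_dvd_units_sub (u v : ℤˣ) : (2 : ℤ) ∣ (u : ℤ) - (v : ℤ) := by
  rcases Int.units_eq_one_or u with rfl | rfl <;>
    rcases Int.units_eq_one_or v with rfl | rfl <;> decide

theorem residue_injective {p ℓ : Fin 3 → ℤ} (h01 : IsCoprime (p 0) (p 1))
    (h02 : IsCoprime (p 0) (p 2)) (h12 : IsCoprime (p 1) (p 2))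
    (hℓ : ∀ j, 0 < ℓ j ∧ ℓ j < p j) {ε δ : Fin 3 → ℤˣ}
    (h : residue p ℓ ε ≡ residue p ℓ δ [ZMOD 2 * (p 0 * p 1 * p 2)]) : ε = δ := by
  obtain ⟨m, hm⟩ := h.symm.dvd
  simp only [residue] at hm
  obtain ⟨x, hx⟩ := two_dvd_units_sub (ε 0) (δ 0)
  obtain ⟨y, hy⟩ := two_dvd_units_sub (ε 1) (δ 1)
  obtain ⟨z, hz⟩ := two_dvd_units_sub (ε 2) (δ 2)
  have e0 : ε 0 = δ 0 := by
    refine sign_eq_of_dvd (hℓ 0).1 (hℓ 0).2 (h01.mul_right h02)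
      ⟨p 1 * p 2 * m - y * ℓ 1 * p 2 - z * ℓ 2 * p 1, ?_⟩
    linear_combination hm - hy * ℓ 1 * (p 0 * p 2) - hz * ℓ 2 * (p 0 * p 1)
  have e1 : ε 1 = δ 1 := by
    refine sign_eq_of_dvd (hℓ 1).1 (hℓ 1).2 (h01.symm.mul_right h12)
      ⟨p 0 * p 2 * m - x * ℓ 0 * p 2 - z * ℓ 2 * p 0, ?_⟩
    linear_combination hm - hx * ℓ 0 * (p 1 * p 2) - hz * ℓ 2 * (p 0 * p 1)
  have e2 : ε 2 = δ 2 := by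
    refine sign_eq_of_dvd (hℓ 2).1 (hℓ 2).2 (h02.symm.mul_right h12.symm)
      ⟨p 0 * p 1 * m - x * ℓ 0 * p 1 - y * ℓ 1 * p 0, ?_⟩
    linear_combination hm - hx * ℓ 0 * (p 1 * p 2) - hy * ℓ 1 * (p 0 * p 2)
  funext j
  fin_cases j
  · exact e0
  · exact e1
  · exact e2

/-- For pairwise coprime `p j` and `0 < ℓ j < p j`, the function `χ` has the prescribed values. -/
theorem chi_eq_of_modEq {p ℓ : Fin 3 → ℤ} (h01 : IsCoprime (p 0) (p 1))
    (h02 : IsCoprime (p 0) (p 2)) (h12 : IsCoprime (p 1) (p 2))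
    (hℓ : ∀ j, 0 < ℓ j ∧ ℓ j < p j) {n : ℤ} {ε : Fin 3 → ℤˣ}
    (h : n ≡ residue p ℓ ε [ZMOD 2 * (p 0 * p 1 * p 2)]) :
    chi p ℓ n = -((ε 0 : ℤ) * (ε 1 : ℤ) * (ε 2 : ℤ)) := by
  unfold chi
  rw [Finset.sum_eq_single ε, if_pos h]
  · intro δ _ hδ
    exact if_neg fun h' => hδ (residue_injective h01 h02 h12 hℓ (h'.symm.trans h))
  · intro h'
    exact absurd (Finset.mem_univ ε) h'

/-- The function `Φ(τ) = ∑ χ(n) q ^ (n² / (4P))`, the sum running over `n ≥ 0`. -/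
def Phi (p ℓ : Fin 3 → ℤ) (τ : ℂ) : ℂ :=
  ∑' n : ℕ, (chi p ℓ (n : ℤ) : ℂ) *
    qPow ((n : ℝ) ^ 2 / (4 * ((p 0 * p 1 * p 2 : ℤ) : ℝ))) τ

/-- The point `1 / N + i t` of the vertical line through `1 / N`. -/
def vert (N : ℕ) (t : ℝ) : ℂ := 1 / (N : ℂ) + Complex.I * (t : ℂ)

/-- The factor `q ^ (- e_k / (24 (6p - 1)))`. -/
def prefactor (p : ℕ) (k : Fin 5) (τ : ℂ) : ℂ :=
  qPow (-((expE p k : ℤ) : ℝ) / (24 * (6 * (p : ℝ) - 1))) τ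

/-- The part of the false theta expression of the `k`-th family that belongs to `c₁`. -/
def c1Half (p : ℕ) (k : Fin 5) (τ : ℂ) : ℂ :=
  prefactor p k τ / (2 * ModularForm.eta τ) *
    ∑ ε₁ ∈ Finset.range 2, ∑ ε₂ ∈ Finset.range 2, (-1 : ℂ) ^ (ε₁ + ε₂) *
      falseTheta2 (matA p) (vecMu p k + ![(ε₁ : ℝ), (ε₂ : ℝ)]) (vecC1 p) τ

end

end FalseTheta

/-!
The `c₁`-part and the partial theta function are proportional in the whole upper half plane, and the
partial theta function has a vertical limit at `1 / N`.

*The identity.* Put `M = 6p - 1`. The four false theta functions, taken with their signs, form one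
sum over `x ∈ ℤ²` with the character `(-1) ^ (x₁ + x₂)`. As `B(x, c₁)` is a positive multiple of the
first coordinate and `Q(x) = 3/2 (x₂ + 2/3 x₁)² + M/6 x₁²`, the sum over the second coordinate
carries no sign function, and it is a series `∑ (-1)ⁿ q ^ (3/2 (n + w/6)²)` with `w` odd. By the
pentagonal number theorem this is `(12 / w) η(τ)` with the Kronecker symbol `(12 / w)`
(`tsum_neg_one_zpow_mul_qPow`), so that `η` cancels. What remains is a false theta
function in one variable, supported on the class of `3 m₁ - 2 m₂` modulo `2M`. Since
`3 m₁ - 2 m₂ = c M + 6 σ ℓ` with `c` odd and `σ = ± 1`, this class contains the residues of `χ` with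
`ε₃ = σ`, and because `χ` is odd, these account for all of `Φ` (`Phi_eq_tsum`). The signs are
compared in `exists_family_data`, and the outcome is `c1Half_eq`.

*The limit.* At `τ = 1 / N + i t` the series `Φ` is `∑ f(n) exp (-s n²)` with `s` proportional to
`t` and a sequence `f` that is periodic and odd, hence of mean zero over a period
(`exists_tendsto_Phi`). For such sequences the limit `s → 0+` exists by summation by parts
(`exists_tendsto_tsum_periodic`).
-/

namespace FalseTheta

/-! ### The pentagonal number theorem and the eta function -/

theorem norm_prod_one_sub_pow_le {x : ℂ} (hx : ‖x‖ < 1) (k n : ℕ) :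
    ‖∏ i ∈ Finset.range n, (1 - x ^ (k + i + 1))‖ ≤ Real.exp (1 - ‖x‖)⁻¹ := by
  calc ‖∏ i ∈ Finset.range n, (1 - x ^ (k + i + 1))‖
      = ∏ i ∈ Finset.range n, ‖1 - x ^ (k + i + 1)‖ := by rw [norm_prod]
    _ ≤ ∏ i ∈ Finset.range n, Real.exp (‖x‖ ^ i) := by
        refine Finset.prod_le_prod (fun _ _ => norm_nonneg _) fun i _ => ?_
        refine (norm_sub_le _ _).trans ?_
        rw [norm_one, norm_pow, add_comm]
        refine le_trans ?_ (Real.add_one_le_exp _)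
        gcongr ?_ + 1
        exact pow_le_pow_of_le_one (norm_nonneg _) hx.le (by omega)
    _ = Real.exp (∑ i ∈ Finset.range n, ‖x‖ ^ i) := by rw [Real.exp_sum]
    _ ≤ Real.exp (1 - ‖x‖)⁻¹ := by
        rw [Real.exp_le_exp, ← tsum_geometric_of_lt_one (norm_nonneg _) hx]
        exact (summable_geometric_of_lt_one (norm_nonneg _) hx).sum_le_tsum _
          fun _ _ => by positivity

theorem norm_pow_mul_prod_one_sub_pow_le {x : ℂ} (hx : ‖x‖ < 1) (k n : ℕ) :
    ‖x ^ ((k + 1) * n) * ∏ i ∈ Finset.range (n + 1), (1 - x ^ (k + i + 1))‖ ≤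
      ‖x‖ ^ n * Real.exp (1 - ‖x‖)⁻¹ := by
  rw [norm_mul, norm_pow]
  refine mul_le_mul ?_ (norm_prod_one_sub_pow_le hx k _) (norm_nonneg _) (by positivity)
  exact pow_le_pow_of_le_one (norm_nonneg _) hx.le (by nlinarith)

theorem summable_pow_pentagonal {x : ℂ} (hx : ‖x‖ < 1) :
    Summable fun n : ℤ => (-1 : ℂ) ^ n * x ^ pentagonal n := by
  have hg := summable_geometric_of_lt_one (norm_nonneg _) hx
  refine Summable.of_norm ?_
  simp only [norm_mul, norm_zpow, norm_neg, norm_one, one_zpow, one_mul, norm_pow]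
  exact hg.comp_injective pentagonal_injective

/-- The pentagonal number theorem for a complex number of absolute value less than one. -/
theorem tprod_one_sub_pow_eq_tsum_pentagonal {x : ℂ} (hx : ‖x‖ < 1) :
    ∏' n : ℕ, (1 - x ^ (n + 1)) = ∑' n : ℤ, (-1 : ℂ) ^ n * x ^ pentagonal (-n) := by
  have hg := summable_geometric_of_lt_one (norm_nonneg _) hx
  have hs : Summable fun n : ℤ => (-1 : ℂ) ^ n * x ^ pentagonal (-n) := by
    have h := (Equiv.neg ℤ).summable_iff.mpr (summable_pow_pentagonal hx)
    refine h.congr fun n => ?_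
    rw [Function.comp_apply, Equiv.neg_apply, zpow_neg, ← inv_zpow]
    norm_num
  have h1 : Summable fun n : ℕ => (-1 : ℂ) ^ n * x ^ pentagonal (-n) := by
    simpa [Function.comp_def] using hs.comp_injective (i := fun n : ℕ => (n : ℤ)) Nat.cast_injective
  have h2' : ∀ n : ℕ, (-1 : ℂ) ^ (-((n : ℤ) + 1)) * x ^ pentagonal (-(-((n : ℤ) + 1)))
      = -((-1 : ℂ) ^ n * x ^ pentagonal (n + 1)) := by
    intro n
    rw [neg_neg, zpow_neg, ← inv_zpow, zpow_add₀ (by norm_num)]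
    norm_num
  have h2 : Summable fun n : ℕ => -((-1 : ℂ) ^ n * x ^ pentagonal (n + 1)) := by
    refine (hs.comp_injective (i := fun n : ℕ => -((n : ℤ) + 1)) ?_).congr fun n => h2' n
    intro a b h
    simpa using h
  rw [Pentagonal.tprod_one_sub_pow]
  · rw [tsum_of_nat_of_neg_add_one (f := fun n : ℤ => (-1 : ℂ) ^ n * x ^ pentagonal (-n))]
    · simp only [h2', zpow_natCast]
      rw [← h1.tsum_add h2]
      refine tsum_congr fun n => by ring
    · simpa using h1
    · simpa only [h2'] using h2
  · exact tendsto_pow_atTop_nhds_zero_of_norm_lt_one hx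
  · intro k
    exact .of_norm_bounded (hg.mul_right _) (norm_pow_mul_prod_one_sub_pow_le hx k)
  · intro k
    have := multipliable_one_add_of_summable (f := fun n : ℕ => -x ^ (n + k + 1)) (by
      simpa [add_assoc] using (summable_nat_add_iff (k + 1)).mpr hg)
    simpa [sub_eq_add_neg] using this
  · refine (h1.add h2).congr fun n => by ring
  · have hb : ∀ k : ℕ, ‖∑' n : ℕ, x ^ ((k + 1) * n) *
        ∏ i ∈ Finset.range (n + 1), (1 - x ^ (k + i + 1))‖
        ≤ ∑' n : ℕ, ‖x‖ ^ n * Real.exp (1 - ‖x‖)⁻¹ := fun k =>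
      tsum_of_norm_bounded (hg.mul_right _).hasSum (norm_pow_mul_prod_one_sub_pow_le hx k)
    have hlim : Filter.Tendsto (fun k : ℕ => ‖x‖ ^ k * ∑' n : ℕ, ‖x‖ ^ n * Real.exp (1 - ‖x‖)⁻¹)
        Filter.atTop (nhds 0) := by
      simpa using (tendsto_pow_atTop_nhds_zero_of_lt_one (norm_nonneg _) hx).mul_const
        (∑' n : ℕ, ‖x‖ ^ n * Real.exp (1 - ‖x‖)⁻¹)
    refine squeeze_zero_norm (fun k => ?_) hlim
    rw [norm_mul, norm_mul, norm_pow, norm_pow, norm_neg, norm_one, one_pow, one_mul]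
    refine mul_le_mul ?_ (hb k) (norm_nonneg _) (by positivity)
    refine pow_le_pow_of_le_one (norm_nonneg _) hx.le ?_
    rw [Nat.le_div_iff_mul_le (by norm_num)]
    nlinarith

theorem qPow_add (r s : ℝ) (τ : ℂ) : qPow (r + s) τ = qPow r τ * qPow s τ := by
  simp only [qPow, ← Complex.exp_add]
  push_cast
  ring_nf

theorem norm_qPow (r : ℝ) (τ : ℂ) : ‖qPow r τ‖ = Real.exp (-(2 * Real.pi * τ.im * r)) := by
  rw [qPow, Complex.norm_exp]
  congr 1
  rw [show (2 * Real.pi * Complex.I * r * τ : ℂ) = ((2 * Real.pi * r : ℝ) : ℂ) * (Complex.I * τ) by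
    push_cast; ring, Complex.re_ofReal_mul, Complex.I_mul_re]
  ring

theorem eta_eq_tsum {τ : ℂ} (hτ : 0 < τ.im) :
    ModularForm.eta τ =
      ∑' n : ℤ, (-1 : ℂ) ^ n * qPow (3 / 2 * ((n : ℝ) + 1 / 6) ^ 2) τ := by
  have hx : ‖qPow 1 τ‖ < 1 := by
    rw [norm_qPow, Real.exp_lt_one_iff]
    have := Real.pi_pos
    simp only [Left.neg_neg_iff]
    positivity
  have h1 : ∀ n, ModularForm.eta_q n τ = qPow 1 τ ^ (n + 1) := by
    intro n
    rw [ModularForm.eta_q_eq_pow, qPow]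
    congr 2
    push_cast; ring
  have h2 : Function.Periodic.qParam 24 τ = qPow (1 / 24) τ := by
    rw [Function.Periodic.qParam, qPow]
    congr 1
    push_cast; ring
  rw [ModularForm.eta, h2]
  simp only [h1]
  rw [tprod_one_sub_pow_eq_tsum_pentagonal hx, ← tsum_mul_left]
  refine tsum_congr fun n => ?_
  have h3 : qPow 1 τ ^ pentagonal (-n) = qPow (pentagonal (-n)) τ := by
    simp only [qPow]
    rw [← Complex.exp_nat_mul]
    congr 1
    push_cast; ring
  have h4 : (2 : ℝ) * pentagonal (-n) = n * (3 * n + 1) := by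
    exact_mod_cast two_mul_natCast_pentagonal_neg n
  rw [h3, mul_left_comm, ← qPow_add]
  congr 2
  linear_combination (1 / 2) * h4

/-- The Kronecker symbol `(12 / d)`: it is `1` for `d ≡ ±1 mod 12`, `-1` for `d ≡ ±5 mod 12`
and `0` for all other `d`. -/
def kron12 (d : ℤ) : ℤ :=
  if d % 12 = 1 ∨ d % 12 = 11 then 1 else if d % 12 = 5 ∨ d % 12 = 7 then -1 else 0

theorem neg_one_zpow_eq (n : ℤ) : (-1 : ℂ) ^ n = if n % 2 = 0 then 1 else -1 := by
  split_ifs with h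
  · exact (Int.even_iff.mpr h).neg_one_zpow
  · exact (Int.odd_iff.mpr (by omega)).neg_one_zpow

/-- The unary theta series `∑ (-1)ⁿ q ^ (3/2 (n + w/6)²)` for odd `w` is `0` or `± η`: translations
and the reflection `n ↦ -n` reduce `w` modulo `6` to `1`, where this is the pentagonal number
theorem, or to `3`, where a reflection cancels the terms in pairs. -/
theorem tsum_neg_one_zpow_mul_qPow {τ : ℂ} (hτ : 0 < τ.im) {w : ℤ} (hw : Odd w) :
    ∑' n : ℤ, (-1 : ℂ) ^ n * qPow (3 / 2 * ((n : ℝ) + w / 6) ^ 2) τ =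
      kron12 w * ModularForm.eta τ := by
  have h6 : w % 6 = 1 ∨ w % 6 = 5 ∨ w % 6 = 3 := by
    have := Int.odd_iff.mp hw
    omega
  rcases h6 with h | h | h
  · obtain ⟨j, rfl⟩ : ∃ j, w = 6 * j + 1 := ⟨w / 6, by omega⟩
    have hk : (kron12 (6 * j + 1) : ℂ) = (-1) ^ j := by
      rw [neg_one_zpow_eq, kron12]
      split_ifs <;> first | omega | norm_num
    rw [eta_eq_tsum hτ, hk, ← tsum_mul_left, ← (Equiv.subRight j).tsum_eq]
    refine tsum_congr fun n => ?_
    rw [← mul_assoc, ← zpow_add₀ (by norm_num), Equiv.subRight_apply]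
    congr 1
    · rw [neg_one_zpow_eq, neg_one_zpow_eq]
      split_ifs <;> first | omega | rfl
    · congr 1
      push_cast
      ring
  · obtain ⟨j, rfl⟩ : ∃ j, w = 6 * j - 1 := ⟨w / 6 + 1, by omega⟩
    have hk : (kron12 (6 * j - 1) : ℂ) = (-1) ^ j := by
      rw [neg_one_zpow_eq, kron12]
      split_ifs <;> first | omega | norm_num
    rw [eta_eq_tsum hτ, hk, ← tsum_mul_left, ← (Equiv.subLeft (-j)).tsum_eq]
    refine tsum_congr fun n => ?_
    rw [← mul_assoc, ← zpow_add₀ (by norm_num), Equiv.subLeft_apply]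
    congr 1
    · rw [neg_one_zpow_eq, neg_one_zpow_eq]
      split_ifs <;> first | omega | rfl
    · congr 1
      push_cast
      ring
  · obtain ⟨j, rfl⟩ : ∃ j, w = 6 * j + 3 := ⟨w / 6, by omega⟩
    have hk : kron12 (6 * j + 3) = 0 := by
      rw [kron12]
      split_ifs <;> omega
    rw [hk, Int.cast_zero, zero_mul, ← self_eq_neg, ← tsum_neg]
    conv_lhs => rw [← (Equiv.subLeft (-1 - 2 * j)).tsum_eq]
    refine tsum_congr fun n => ?_
    rw [← neg_mul, Equiv.subLeft_apply]
    congr 1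
    · rw [neg_one_zpow_eq, neg_one_zpow_eq]
      split_ifs <;> first | omega | norm_num
    · congr 1
      push_cast
      ring

/-! ### Summability -/

theorem summable_exp_neg_mul_sq {a : ℝ} (ha : 0 < a) (b : ℝ) :
    Summable fun n : ℤ => Real.exp (-(a * ((n : ℝ) + b) ^ 2)) := by
  have hpi := Real.pi_pos
  have h := summable_pow_mul_jacobiTheta₂_term_bound (a * |b| / Real.pi) (div_pos ha hpi) 0
  refine .of_nonneg_of_le (fun n => (Real.exp_pos _).le) (fun n => ?_) h
  rw [pow_zero, one_mul, Real.exp_le_exp, Int.cast_abs]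
  have h1 : -Real.pi * (a / Real.pi * (n : ℝ) ^ 2 - 2 * (a * |b| / Real.pi) * |(n : ℝ)|) =
      -(a * (n : ℝ) ^ 2) + 2 * a * (|b| * |(n : ℝ)|) := by
    field_simp
    ring
  rw [h1, ← abs_mul]
  nlinarith [neg_abs_le (b * n), mul_nonneg ha.le (sq_nonneg b),
    mul_le_mul_of_nonneg_left (neg_abs_le (b * (n : ℝ))) ha.le]

/-- The sum over a lattice of rank two, split according to the parities of both coordinates. -/
theorem sum_parity_tsum_eq {F : ℤ × ℤ → ℂ} (hF : Summable F) :
    ∑ i ∈ Finset.range 2, ∑ j ∈ Finset.range 2,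
      ∑' n : Fin 2 → ℤ, F (2 * n 0 + i, 2 * n 1 + j) = ∑' x, F x := by
  let e : (Fin 2 × Fin 2) × (ℤ × ℤ) ≃ ℤ × ℤ :=
    (Equiv.prodComm _ _).trans ((Equiv.prodProdProdComm ℤ ℤ (Fin 2) (Fin 2)).trans
      ((Int.divModEquiv 2).symm.prodCongr (Int.divModEquiv 2).symm))
  have he : ∀ i j : Fin 2, ∀ x : ℤ × ℤ, e ((i, j), x) = (2 * x.1 + i, 2 * x.2 + j) := by
    intro i j x
    simp [e, Int.divModEquiv, mul_comm]
  rw [← e.tsum_eq, Summable.tsum_prod (f := fun c => F (e c)) (e.summable_iff.mpr hF), tsum_fintype,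
    Fintype.sum_prod_type, Finset.sum_range]
  refine Finset.sum_congr rfl fun i _ => ?_
  rw [Finset.sum_range]
  refine Finset.sum_congr rfl fun j _ => ?_
  rw [← (finTwoArrowEquiv ℤ).tsum_eq]
  refine tsum_congr fun n => ?_
  rw [he]
  rfl

/-! ### The periodic function `χ` -/

/-- The part of `χ` carried by the residue classes with `ε 2 = σ`. -/
def chiHalf (p ℓ : Fin 3 → ℤ) (σ : ℤˣ) (n : ℤ) : ℤ :=
  ∑ ε : Fin 3 → ℤˣ,
    if ε 2 = σ ∧ n ≡ residue p ℓ ε [ZMOD 2 * (p 0 * p 1 * p 2)] then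
      -((ε 0 : ℤ) * (ε 1 : ℤ) * (ε 2 : ℤ)) else 0

theorem neg_modEq_residue_neg (p ℓ : Fin 3 → ℤ) (ε : Fin 3 → ℤˣ) (n : ℤ) :
    -n ≡ residue p ℓ (-ε) [ZMOD 2 * (p 0 * p 1 * p 2)] ↔
      n ≡ residue p ℓ ε [ZMOD 2 * (p 0 * p 1 * p 2)] := by
  have h : residue p ℓ (-ε) - -n =
      -(residue p ℓ ε - n) + 2 * (p 0 * p 1 * p 2) * 1 := by
    simp only [residue, Pi.neg_apply, Units.val_neg]
    ring
  rw [Int.modEq_iff_dvd, Int.modEq_iff_dvd, h, dvd_add_left (dvd_mul_right _ _), dvd_neg]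

theorem chi_eq_chiHalf_sub (p ℓ : Fin 3 → ℤ) (σ : ℤˣ) (n : ℤ) :
    chi p ℓ n = chiHalf p ℓ σ n - chiHalf p ℓ σ (-n) := by
  have h : chiHalf p ℓ σ (-n) = ∑ ε : Fin 3 → ℤˣ,
      if ε 2 ≠ σ ∧ n ≡ residue p ℓ ε [ZMOD 2 * (p 0 * p 1 * p 2)] then
        ((ε 0 : ℤ) * (ε 1 : ℤ) * (ε 2 : ℤ)) else 0 := by
    rw [chiHalf, ← Equiv.sum_comp (Equiv.neg (Fin 3 → ℤˣ))]
    refine Finset.sum_congr rfl fun ε _ => ?_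
    have hs : -ε 2 = σ ↔ ε 2 ≠ σ := by
      rcases Int.units_eq_one_or (ε 2) with h | h <;>
        rcases Int.units_eq_one_or σ with h' | h' <;> rw [h, h'] <;> decide
    simp only [Equiv.neg_apply, neg_modEq_residue_neg, Pi.neg_apply, hs, Units.val_neg]
    congr 1
    ring
  rw [h, chiHalf, chi, ← Finset.sum_sub_distrib]
  refine Finset.sum_congr rfl fun ε _ => ?_
  split_ifs <;> first | tauto | ring

theorem chi_neg (p ℓ : Fin 3 → ℤ) (n : ℤ) : chi p ℓ (-n) = -chi p ℓ n := by
  rw [chi_eq_chiHalf_sub p ℓ 1, chi_eq_chiHalf_sub p ℓ 1, neg_neg, neg_sub]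

theorem chi_zero (p ℓ : Fin 3 → ℤ) : chi p ℓ 0 = 0 := by
  simpa using chi_eq_chiHalf_sub p ℓ 1 0

theorem chi_add_period (p ℓ : Fin 3 → ℤ) (n j : ℤ) :
    chi p ℓ (n + 2 * (p 0 * p 1 * p 2) * j) = chi p ℓ n := by
  simp only [chi, Int.add_modulus_mul_modEq_iff]

theorem norm_chiHalf_le (p ℓ : Fin 3 → ℤ) (σ : ℤˣ) (n : ℤ) : ‖(chiHalf p ℓ σ n : ℂ)‖ ≤ 8 := by
  rw [chiHalf, Int.cast_sum]
  refine (norm_sum_le_of_le (f := _) (n := fun _ => 1) _ fun ε _ => ?_).trans ?_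
  · split_ifs
    · rcases Int.units_eq_one_or (ε 0) with h | h <;>
        rcases Int.units_eq_one_or (ε 1) with h' | h' <;>
          rcases Int.units_eq_one_or (ε 2) with h'' | h'' <;> simp [h, h', h'']
    · simp
  · simp

theorem residue_two_three (M l : ℤ) (ε : Fin 3 → ℤˣ) :
    residue ![2, 3, M] ![1, 1, l] ε =
      (6 + 3 * (ε 0 : ℤ) + 2 * (ε 1 : ℤ)) * M + 6 * (ε 2 : ℤ) * l := by
  simp [residue]
  ring

theorem exists_odd_of_chiHalf_ne_zero {M l : ℤ} {σ : ℤˣ} {n : ℤ}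
    (h : chiHalf ![2, 3, M] ![1, 1, l] σ n ≠ 0) :
    ∃ d : ℤ, Odd d ∧ n = d * M + 6 * σ * l := by
  obtain ⟨ε, -, hε⟩ := Finset.exists_ne_zero_of_sum_ne_zero h
  obtain ⟨⟨rfl, h2⟩, -⟩ := ite_ne_right_iff.mp hε
  rw [residue_two_three] at h2
  obtain ⟨j, hj⟩ := h2.symm.dvd
  refine ⟨6 + 3 * ε 0 + 2 * ε 1 + 12 * j, ?_, ?_⟩
  · rcases Int.units_eq_one_or (ε 0) with h | h <;> rw [h] <;> rw [Int.odd_iff] <;> push_cast <;>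
      omega
  · simp at hj
    linear_combination hj

theorem sum_three_units (f : ℤˣ → ℤˣ → ℤˣ → ℤ) :
    ∑ ε : Fin 3 → ℤˣ, f (ε 0) (ε 1) (ε 2) = ∑ a, ∑ b, ∑ c, f a b c := by
  let e : (Fin 3 → ℤˣ) ≃ ℤˣ × ℤˣ × ℤˣ :=
    { toFun := fun ε => (ε 0, ε 1, ε 2)
      invFun := fun x => ![x.1, x.2.1, x.2.2]
      left_inv := fun ε => by
        funext j
        fin_cases j <;> rfl
      right_inv := fun x => rfl }
  rw [← e.symm.sum_comp, Fintype.sum_prod_type]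
  refine Finset.sum_congr rfl fun a _ => ?_
  rw [Fintype.sum_prod_type]
  rfl

theorem chiHalf_two_three {M l d : ℤ} (hM : M ≠ 0) (σ : ℤˣ) (hd : Odd d) :
    chiHalf ![2, 3, M] ![1, 1, l] σ (d * M + 6 * σ * l) = -(σ * kron12 d) := by
  have h1 : ∀ ε : Fin 3 → ℤˣ, (ε 2 = σ ∧ d * M + 6 * σ * l ≡ residue ![2, 3, M] ![1, 1, l] ε
      [ZMOD 2 * (![2, 3, M] 0 * ![2, 3, M] 1 * ![2, 3, M] 2)]) ↔
      (ε 2 = σ ∧ (12 : ℤ) ∣ 6 + 3 * ε 0 + 2 * ε 1 - d) := by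
    intro ε
    refine and_congr_right fun hε => ?_
    rw [residue_two_three, hε, Int.modEq_iff_dvd, ← mul_dvd_mul_iff_right (a := 12) hM]
    simp only [Matrix.cons_val]
    ring_nf
  have hd' := Int.odd_iff.mp hd
  have hne : (1 : ℤˣ) ≠ -1 := by decide
  rw [chiHalf]
  simp only [h1]
  rw [sum_three_units fun a b c => if c = σ ∧ (12 : ℤ) ∣ 6 + 3 * a + 2 * b - d then
    -((a : ℤ) * b * c) else 0]
  simp only [ite_and, Finset.sum_ite_eq', Finset.mem_univ, if_true]
  simp only [UnitsInt.univ, Finset.sum_pair hne, Units.val_one, Units.val_neg, kron12]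
  rcases Int.units_eq_one_or σ with rfl | rfl <;> simp only [Units.val_one, Units.val_neg] <;>
    split_ifs <;> omega

/-! ### Gaussian summation of periodic sequences of mean zero -/

theorem periodic_sum_range {f : ℕ → ℂ} {K : ℕ} (hf : Function.Periodic f K)
    (h0 : ∑ i ∈ Finset.range K, f i = 0) :
    Function.Periodic (fun n => ∑ i ∈ Finset.range n, f i) K := by
  intro n
  simp only
  rw [add_comm, Finset.sum_range_add, h0, zero_add]
  exact Finset.sum_congr rfl fun i _ => by rw [add_comm, hf]

theorem exists_norm_le_of_periodic {f : ℕ → ℂ} {K : ℕ} (hK : 0 < K)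
    (hf : Function.Periodic f K) : ∃ B, ∀ n, ‖f n‖ ≤ B := by
  refine ⟨∑ i ∈ Finset.range K, ‖f i‖, fun n => ?_⟩
  rw [← hf.map_mod_nat n]
  exact Finset.single_le_sum (f := fun i => ‖f i‖) (fun _ _ => norm_nonneg _)
    (Finset.mem_range.mpr (Nat.mod_lt n hK))

/-- The second difference of `x ↦ exp (-s x²)`, bounded uniformly in `s`. -/
theorem abs_second_difference_exp_le {s : ℝ} (hs : 0 ≤ s) (n : ℕ) :
    |Real.exp (-s * (n : ℝ) ^ 2) - 2 * Real.exp (-s * ((n + 1 : ℕ) : ℝ) ^ 2) +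
      Real.exp (-s * ((n + 2 : ℕ) : ℝ) ^ 2)| ≤ 80 * (1 / ((n + 1 : ℕ) : ℝ) ^ 2) := by
  have hn : (0 : ℝ) ≤ n := Nat.cast_nonneg n
  set E := Real.exp (-s * (n : ℝ) ^ 2) with hE
  set u := Real.exp (-(s * (2 * n + 1))) with hu
  set v := Real.exp (-(2 * s)) with hv
  have e1 : Real.exp (-s * ((n + 1 : ℕ) : ℝ) ^ 2) = E * u := by
    rw [hE, hu, ← Real.exp_add]; congr 1; push_cast; ring
  have e2 : Real.exp (-s * ((n + 2 : ℕ) : ℝ) ^ 2) = E * (u ^ 2 * v) := by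
    rw [hE, hu, hv, ← Real.exp_nat_mul, ← Real.exp_add, ← Real.exp_add]
    congr 1; push_cast; ring
  have hE0 : 0 < E := Real.exp_pos _
  have hu0 : 0 < u := Real.exp_pos _
  have hv0 : 0 < v := Real.exp_pos _
  have hu1 : u ≤ 1 := Real.exp_le_one_iff.mpr (by nlinarith [mul_nonneg hs hn])
  have hv1 : v ≤ 1 := Real.exp_le_one_iff.mpr (by linarith)
  have hu2 : 1 - u ≤ s * (2 * n + 1) := by
    have := Real.add_one_le_exp (-(s * (2 * n + 1)))
    linarith
  have hv2 : 1 - v ≤ 2 * s := by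
    have := Real.add_one_le_exp (-(2 * s))
    linarith
  -- the polynomial factors are absorbed by `1 + x + x² / 2 ≤ exp x` at `x = s n²`
  have hq : E * (1 + s * n ^ 2 + (s * n ^ 2) ^ 2 / 2) ≤ 1 := by
    have h := Real.quadratic_le_exp_of_nonneg (mul_nonneg hs (sq_nonneg (n : ℝ)))
    calc E * (1 + s * n ^ 2 + (s * n ^ 2) ^ 2 / 2) ≤ E * Real.exp (s * n ^ 2) := by gcongr
      _ = 1 := by rw [hE, ← Real.exp_add, neg_mul, neg_add_cancel, Real.exp_zero]
  have hfac : E - 2 * (E * u) + E * (u ^ 2 * v) = E * ((1 - u) ^ 2 - u ^ 2 * (1 - v)) := by ring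
  rw [e1, e2, hfac, abs_mul, abs_of_pos hE0, mul_one_div, le_div_iff₀ (by positivity)]
  have hu3 : (1 - u) ^ 2 ≤ (s * (2 * n + 1)) ^ 2 := by
    have : 0 ≤ 1 - u := by linarith
    gcongr
  have hu4 : u ^ 2 ≤ 1 := pow_le_one₀ hu0.le hu1
  have huv0 : 0 ≤ u ^ 2 * (1 - v) := mul_nonneg (sq_nonneg _) (by linarith)
  have habs : |(1 - u) ^ 2 - u ^ 2 * (1 - v)| ≤ (s * (2 * n + 1)) ^ 2 + 2 * s := by
    have : u ^ 2 * (1 - v) ≤ 1 * (2 * s) := by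
      apply mul_le_mul hu4 hv2 (by linarith) zero_le_one
    rw [abs_le]
    constructor <;> nlinarith [sq_nonneg (1 - u), sq_nonneg (s * (2 * (n : ℝ) + 1))]
  rcases Nat.eq_zero_or_pos n with h0 | h0
  · have hE1 : E = 1 := by rw [hE, h0]; simp
    have : |(1 - u) ^ 2 - u ^ 2 * (1 - v)| ≤ 2 := by
      rw [abs_le]
      constructor <;> nlinarith
    rw [hE1, h0]
    norm_num
    linarith
  · have h1 : (1 : ℝ) ≤ n := by exact_mod_cast h0
    have hx : 0 ≤ s * (n : ℝ) ^ 2 := by positivity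
    calc E * |(1 - u) ^ 2 - u ^ 2 * (1 - v)| * ((n + 1 : ℕ) : ℝ) ^ 2
        ≤ E * ((s * (3 * n)) ^ 2 + 2 * s) * (2 * n) ^ 2 := by
          push_cast
          gcongr
          · refine habs.trans ?_
            gcongr
            linarith
          · linarith
      _ = E * (36 * (s * n ^ 2) ^ 2 + 8 * (s * n ^ 2)) := by ring
      _ ≤ E * (80 * (1 + s * n ^ 2 + (s * n ^ 2) ^ 2 / 2)) := by
          gcongr
          nlinarith
      _ ≤ 80 := by linarith

/-- A periodic sequence of mean zero is summable to a finite value by the means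
`∑ c n * exp (-s n²)`, `s → 0+`. Such a sequence is the second difference of a bounded sequence, so
summation by parts twice leaves a series over the second differences of `exp (-s n²)`, to which
dominated convergence applies. -/
theorem exists_tendsto_tsum_periodic {c : ℕ → ℂ} {K : ℕ} (hK : 0 < K)
    (hc : Function.Periodic c K) (h0 : ∑ i ∈ Finset.range K, c i = 0) :
    ∃ l : ℂ, Filter.Tendsto
      (fun s : ℝ => ∑' n : ℕ, c n * (Real.exp (-s * (n : ℝ) ^ 2) : ℂ))
      (nhdsWithin 0 (Set.Ioi 0)) (nhds l) := by
  set C : ℕ → ℂ := fun n => ∑ i ∈ Finset.range n, c i with hC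
  -- subtracting the mean of `C` makes its partial sums `D` periodic, hence bounded
  set m : ℂ := (∑ i ∈ Finset.range K, C i) / K with hm
  set D : ℕ → ℂ := fun n => ∑ i ∈ Finset.range n, (C i - m) with hD
  have hDper : Function.Periodic D K := by
    refine periodic_sum_range (fun n => ?_) ?_
    · exact congrArg (· - m) (periodic_sum_range hc h0 n)
    · have : (K : ℂ) ≠ 0 := by exact_mod_cast hK.ne'
      rw [Finset.sum_sub_distrib, Finset.sum_const, Finset.card_range, nsmul_eq_mul, hm]
      field_simp
      ring
  obtain ⟨B, hB⟩ := exists_norm_le_of_periodic hK hDper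
  have hcD : ∀ n, c n = D (n + 2) - 2 * D (n + 1) + D n := by
    intro n
    simp only [hD, hC, Finset.sum_range_succ]
    ring
  have hD0 : D 0 = 0 := by simp [hD]
  let g : ℝ → ℕ → ℂ := fun s n => (Real.exp (-s * (n : ℝ) ^ 2) : ℂ)
  have hgnorm : ∀ s n, ‖g s n‖ = Real.exp (-s * (n : ℝ) ^ 2) := fun s n => by
    rw [Complex.norm_real, Real.norm_eq_abs, abs_of_pos (Real.exp_pos _)]
  have hgs : ∀ s, 0 < s → Summable fun n => ‖g s n‖ := by
    intro s hs
    have := (summable_exp_neg_mul_sq hs 0).comp_injective (i := fun n : ℕ => (n : ℤ))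
      Nat.cast_injective
    refine this.congr fun n => ?_
    rw [hgnorm]
    simp
  have key : ∀ s, 0 < s → ∑' n, c n * g s n =
      (∑' n, D (n + 2) * (g s n - 2 * g s (n + 1) + g s (n + 2))) +
        (D 1 * g s 1 - 2 * D 1 * g s 0) := by
    intro s hs
    have hsum : ∀ (i j : ℕ), Summable fun n => D (n + i) * g s (n + j) := by
      intro i j
      have h := ((summable_nat_add_iff j).mpr (hgs s hs)).mul_left B
      refine .of_norm_bounded h fun n => ?_
      rw [norm_mul]
      exact mul_le_mul_of_nonneg_right (hB _) (norm_nonneg _)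
    have s20 : Summable fun n => D (n + 2) * g s n := hsum 2 0
    have s10 : Summable fun n => D (n + 1) * g s n := hsum 1 0
    have s00 : Summable fun n => D n * g s n := hsum 0 0
    have s11 : Summable fun n => D (n + 1) * g s (n + 1) := hsum 1 1
    have s21 : Summable fun n => D (n + 2) * g s (n + 1) := hsum 2 1
    have s22 : Summable fun n => D (n + 2) * g s (n + 2) := hsum 2 2
    have t1 : ∑' n, D (n + 1) * g s n = D 1 * g s 0 + ∑' n, D (n + 2) * g s (n + 1) :=
      s10.tsum_eq_zero_add
    have t0 : ∑' n, D n * g s n = D 1 * g s 1 + ∑' n, D (n + 2) * g s (n + 2) := by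
      rw [s00.tsum_eq_zero_add, s11.tsum_eq_zero_add]
      simp only [hD0, zero_mul, zero_add, add_assoc, Nat.reduceAdd]
    have l1 : ∑' n, c n * g s n = ∑' n, D (n + 2) * g s n - 2 * ∑' n, D (n + 1) * g s n +
        ∑' n, D n * g s n := by
      rw [← tsum_mul_left, ← s20.tsum_sub (s10.mul_left 2),
        ← (s20.sub (s10.mul_left 2)).tsum_add s00]
      refine tsum_congr fun n => ?_
      rw [hcD n]
      ring
    have l2 : ∑' n, D (n + 2) * (g s n - 2 * g s (n + 1) + g s (n + 2)) =
        ∑' n, D (n + 2) * g s n - 2 * ∑' n, D (n + 2) * g s (n + 1) +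
        ∑' n, D (n + 2) * g s (n + 2) := by
      rw [← tsum_mul_left, ← s20.tsum_sub (s21.mul_left 2),
        ← (s20.sub (s21.mul_left 2)).tsum_add s22]
      refine tsum_congr fun n => ?_
      ring
    rw [l1, l2, t0, t1]
    ring
  have hglim : ∀ n, Filter.Tendsto (fun s => g s n) (nhdsWithin 0 (Set.Ioi 0)) (nhds 1) := by
    intro n
    have : Continuous fun s : ℝ => g s n := by fun_prop
    have h := (this.tendsto 0).mono_left (nhdsWithin_le_nhds (s := Set.Ioi 0))
    simpa [g] using h
  have hmain : Filter.Tendsto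
      (fun s => ∑' n, D (n + 2) * (g s n - 2 * g s (n + 1) + g s (n + 2)))
      (nhdsWithin 0 (Set.Ioi 0)) (nhds (∑' _ : ℕ, (0 : ℂ))) := by
    refine tendsto_tsum_of_dominated_convergence
      (bound := fun n : ℕ => B * (80 * (1 / ((n + 1 : ℕ) : ℝ) ^ 2))) ?_ ?_ ?_
    · refine .mul_left _ (.mul_left _ ?_)
      exact (summable_nat_add_iff (f := fun n : ℕ => 1 / (n : ℝ) ^ 2) 1).mpr
        (Real.summable_one_div_nat_pow.mpr one_lt_two)
    · intro n
      have := (((hglim n).sub ((hglim (n + 1)).const_mul 2)).add (hglim (n + 2))).const_mul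
        (D (n + 2))
      convert this using 2
      ring
    · filter_upwards [self_mem_nhdsWithin] with s hs n
      rw [norm_mul]
      refine mul_le_mul (hB _) ?_ (norm_nonneg _) ((norm_nonneg _).trans (hB 0))
      have := abs_second_difference_exp_le (le_of_lt hs) n
      rw [← Real.norm_eq_abs, ← Complex.norm_real] at this
      simpa [g] using this
  refine ⟨_, Filter.Tendsto.congr' ?_
    (hmain.add (((hglim 1).const_mul (D 1)).sub ((hglim 0).const_mul (2 * D 1))))⟩
  filter_upwards [self_mem_nhdsWithin] with s hs
  exact (key s hs).symm

/-! ### The partial theta function `Φ` as a false theta function -/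

/-- The term `sgn(r) q ^ (r² / (24 M))` of a unary false theta function. -/
noncomputable def falseTerm (M : ℝ) (τ : ℂ) (r : ℤ) : ℂ :=
  (r.sign : ℂ) * qPow ((r : ℝ) ^ 2 / (24 * M)) τ

theorem falseTerm_neg (M : ℝ) (τ : ℂ) (r : ℤ) : falseTerm M τ (-r) = -falseTerm M τ r := by
  simp [falseTerm, Int.sign_neg]

theorem summable_norm_falseTerm {M : ℝ} (hM : 0 < M) {τ : ℂ} (hτ : 0 < τ.im) :
    Summable fun r : ℤ => ‖falseTerm M τ r‖ := by
  have ha : 0 < 2 * Real.pi * τ.im / (24 * M) := by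
    have := Real.pi_pos
    positivity
  refine .of_nonneg_of_le (fun _ => norm_nonneg _) (fun r => ?_) (summable_exp_neg_mul_sq ha 0)
  rw [falseTerm, norm_mul, norm_qPow]
  have h1 : ‖(r.sign : ℂ)‖ ≤ 1 := by
    rcases Int.sign_trichotomy r with h | h | h <;> simp [h]
  refine (mul_le_of_le_one_left (Real.exp_pos _).le h1).trans_eq ?_
  congr 2
  ring

/-- Since `χ(r) = ψ(r) - ψ(-r)` with `ψ` the part of `χ` where `ε 2 = σ`, the sum over `n ≥ 0`
defining `Φ` unfolds to a sum of `sgn(r) ψ(r) q ^ (r² / (24 M))` over all integers `r`, and `ψ` is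
supported on a single class modulo `2 M`. -/
theorem Phi_eq_tsum {M l : ℤ} (hM : 0 < M) (σ : ℤˣ) {c : ℤ} (hc : Odd c) {τ : ℂ}
    (hτ : 0 < τ.im) :
    Phi ![2, 3, M] ![1, 1, l] τ = -∑' n : ℤ, ((σ * kron12 (c + 2 * n) : ℤ) : ℂ) *
      falseTerm M τ ((c + 2 * n) * M + 6 * σ * l) := by
  set ψ : ℤ → ℤ := chiHalf ![2, 3, M] ![1, 1, l] σ with hψ
  have hMR : (0 : ℝ) < M := by exact_mod_cast hM
  have hs : Summable fun r : ℤ => (ψ r : ℂ) * falseTerm M τ r := by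
    refine .of_norm_bounded ((summable_norm_falseTerm hMR hτ).mul_left 8) fun r => ?_
    rw [norm_mul]
    exact mul_le_mul_of_nonneg_right (norm_chiHalf_le _ _ _ _) (norm_nonneg _)
  have hterm : ∀ n : ℕ, (chi ![2, 3, M] ![1, 1, l] n : ℂ) *
      qPow ((n : ℝ) ^ 2 / (4 * ((![2, 3, M] 0 * ![2, 3, M] 1 * ![2, 3, M] 2 : ℤ) : ℝ))) τ =
      (ψ n : ℂ) * falseTerm M τ n + (ψ (-n) : ℂ) * falseTerm M τ (-n) := by
    intro n
    rw [falseTerm_neg, mul_neg, ← sub_eq_add_neg, ← sub_mul, ← Int.cast_sub,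
      ← chi_eq_chiHalf_sub, falseTerm]
    have h4 : (4 * ((![2, 3, M] 0 * ![2, 3, M] 1 * ![2, 3, M] 2 : ℤ) : ℝ)) = 24 * M := by
      simp
      ring
    rw [h4]
    rcases Nat.eq_zero_or_pos n with rfl | hn
    · rw [Nat.cast_zero, chi_zero]
      simp
    · rw [Int.sign_natCast_of_ne_zero hn.ne']
      simp
  have hsum : Phi ![2, 3, M] ![1, 1, l] τ = ∑' r : ℤ, (ψ r : ℂ) * falseTerm M τ r := by
    rw [Phi, tsum_congr hterm, tsum_nat_add_neg hs]
    simp [falseTerm]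
  have hinj : Function.Injective fun n : ℤ => (c + 2 * n) * M + 6 * σ * l := by
    intro a b h
    have h2 : (c + 2 * a) * M = (c + 2 * b) * M := by
      simpa using h
    have := mul_right_cancel₀ hM.ne' h2
    omega
  rw [hsum, ← hinj.tsum_eq, ← tsum_neg]
  · refine tsum_congr fun n => ?_
    rw [hψ, chiHalf_two_three hM.ne' σ (hc.add_even (even_two_mul n)), Int.cast_neg, neg_mul]
  · intro r hr
    have hr' : ψ r ≠ 0 := fun h => hr (by simp [h])
    obtain ⟨d, hd, rfl⟩ := exists_odd_of_chiHalf_ne_zero hr'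
    obtain ⟨j, hj⟩ := hd.sub_odd hc
    exact ⟨j, by simp only; rw [show c + 2 * j = d by omega]⟩

/-! ### The limit of `Φ` at `1 / N` -/

theorem exists_tendsto_Phi {p ℓ : Fin 3 → ℤ} (hp : 0 < p 0 * p 1 * p 2) {N : ℕ} (hN : 1 ≤ N) :
    ∃ l : ℂ, Filter.Tendsto (fun t : ℝ => Phi p ℓ (vert N t)) (nhdsWithin 0 (Set.Ioi 0))
      (nhds l) := by
  obtain ⟨P, hP⟩ : ∃ P : ℕ, p 0 * p 1 * p 2 = P := ⟨_, (Int.toNat_of_nonneg hp.le).symm⟩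
  have hP0 : 0 < P := by omega
  have hPC : (P : ℂ) ≠ 0 := by exact_mod_cast hP0.ne'
  have hNC : (N : ℂ) ≠ 0 := by exact_mod_cast (by omega : N ≠ 0)
  let f : ℤ → ℂ := fun n => (chi p ℓ n : ℂ) * qPow ((n : ℝ) ^ 2 / (4 * P)) (1 / N)
  have hf_odd : ∀ n, f (-n) = -f n := by
    intro n
    simp [f, chi_neg]
  have hf_per : ∀ n : ℤ, f (n + (2 * P * N : ℕ)) = f n := by
    intro n
    have h1 := chi_add_period p ℓ n N
    rw [hP] at h1
    simp only [f]
    push_cast at h1 ⊢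
    rw [h1]
    congr 1
    simp only [qPow]
    rw [Complex.exp_eq_exp_iff_exists_int]
    refine ⟨n + P * N, ?_⟩
    push_cast
    field_simp
    ring
  have hf_sum : ∑ i ∈ Finset.range (2 * P * N), f (i : ℕ) = 0 := by
    set K := 2 * P * N with hK
    have h1 : ∑ i ∈ Finset.range K, f (i : ℕ) = ∑ i ∈ Finset.range K, f ((i + 1 : ℕ) : ℤ) := by
      have h := (Finset.sum_range_succ (fun i : ℕ => f i) K).symm.trans
        (Finset.sum_range_succ' (fun i : ℕ => f i) K)
      have hK0 : f (K : ℕ) = f (0 : ℕ) := by simpa using hf_per 0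
      rw [hK0] at h
      exact add_right_cancel h
    have h2 : ∑ i ∈ Finset.range K, f ((i + 1 : ℕ) : ℤ) = -∑ i ∈ Finset.range K, f (i : ℕ) := by
      rw [← Finset.sum_range_reflect, ← Finset.sum_neg_distrib]
      refine Finset.sum_congr rfl fun i hi => ?_
      have hi' := Finset.mem_range.mp hi
      rw [← hf_odd, ← hf_per (-i)]
      congr 1
      omega
    exact self_eq_neg.mp (h1.trans h2)
  obtain ⟨l, hl⟩ := exists_tendsto_tsum_periodic (c := fun n : ℕ => f n) (K := 2 * P * N)
    (by positivity) (fun n => by simpa using hf_per n) hf_sum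
  refine ⟨l, ?_⟩
  have hs : Filter.Tendsto (fun t : ℝ => 2 * Real.pi / (4 * P) * t) (nhdsWithin 0 (Set.Ioi 0))
      (nhdsWithin 0 (Set.Ioi 0)) := by
    have hpos : 0 < 2 * Real.pi / (4 * P) := by
      have := Real.pi_pos
      positivity
    refine tendsto_nhdsWithin_iff.mpr ⟨?_, ?_⟩
    · have : Continuous fun t : ℝ => 2 * Real.pi / (4 * P) * t := by fun_prop
      simpa using (this.tendsto 0).mono_left (nhdsWithin_le_nhds (s := Set.Ioi 0))
    · filter_upwards [self_mem_nhdsWithin] with t ht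
      exact mul_pos hpos ht
  refine (hl.comp hs).congr fun t => ?_
  rw [Function.comp_apply, Phi]
  refine tsum_congr fun n => ?_
  simp only [f, hP, mul_assoc]
  congr 1
  rw [qPow, qPow, Complex.ofReal_exp, ← Complex.exp_add, vert]
  congr 1
  push_cast
  field_simp
  ring_nf
  rw [Complex.I_sq]
  ring

/-! ### Diagonalization of the quadratic form and the five families -/

theorem vecMu_eq {p : ℕ} (hp : 1 ≤ p) {k : Fin 5} {m₁ m₂ : ℝ} (hm : vecM p k = ![m₁, m₂]) :
    vecMu p k = ![(3 * m₁ - 2 * m₂) / (2 * (6 * p - 1)),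
      (-2 * m₁ + (2 * p + 1) * m₂) / (2 * (6 * p - 1))] := by
  have hp' : (1 : ℝ) ≤ p := by exact_mod_cast hp
  have hM : (6 * (p : ℝ) - 1) ≠ 0 := by linarith
  have hdet : (matA p).det = 6 * p - 1 := by
    rw [matA, Matrix.det_fin_two_of]
    ring
  rw [vecMu, hm, Matrix.inv_def, hdet, Ring.inverse_eq_inv', matA, Matrix.adjugate_fin_two_of]
  ext i
  fin_cases i
  · simp
    field_simp
    ring
  · simp
    field_simp

theorem quad_matA (p : ℕ) (x : Fin 2 → ℝ) :
    quad (matA p) x = 3 / 2 * (x 1 + 2 / 3 * x 0) ^ 2 + (6 * p - 1) / 6 * x 0 ^ 2 := by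
  simp [quad, bilin, matA, Matrix.mulVec, dotProduct, Fin.sum_univ_two]
  ring

theorem sign_bilin_vecC1 {p : ℕ} (hp : 1 ≤ p) (x : Fin 2 → ℝ) :
    Real.sign (bilin (matA p) x (vecC1 p)) = Real.sign (x 0) := by
  have hp' : (1 : ℝ) ≤ p := by exact_mod_cast hp
  have hb : bilin (matA p) x (vecC1 p) =
      x 0 * ((6 * p - 1) / Real.sqrt (3 * (6 * (p : ℝ) - 1))) := by
    simp [bilin, matA, vecC1, Matrix.mulVec, dotProduct, Fin.sum_univ_two]
    ring
  have hpos : 0 < (6 * p - 1) / Real.sqrt (3 * (6 * (p : ℝ) - 1)) :=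
    div_pos (by linarith) (Real.sqrt_pos.mpr (by linarith))
  rw [hb]
  rcases lt_trichotomy (x 0) 0 with h | h | h
  · rw [Real.sign_of_neg h, Real.sign_of_neg (mul_neg_of_neg_of_pos h hpos)]
  · rw [h, zero_mul]
  · rw [Real.sign_of_pos h, Real.sign_of_pos (mul_pos h hpos)]

/-- In each of the five families, `c` and `σ` give the residues `c (6p-1) + 6 σ ℓ` of `χ` that the
exponents of the false theta function run through, and the signs contributed by the sum over the
second lattice coordinate are the values of `χ` there, up to a common factor. -/
theorem exists_family_data (p : ℕ) (k : Fin 5) : ∃ (m₁ m₂ c : ℤ) (σ : ℤˣ),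
    vecM p k = ![(m₁ : ℝ), (m₂ : ℝ)] ∧ 3 * m₁ - 2 * m₂ = c * (6 * p - 1) + 6 * σ * ell p k ∧
    Odd m₂ ∧ Odd c ∧
    ∀ n : ℤ, (-1 : ℂ) ^ n * kron12 (m₂ + 4 * n) = ((σ * kron12 (c + 2 * n) : ℤ) : ℂ) := by
  -- both sides have period `6` in `n`
  have key : ∀ (m₂ c : ℤ) (σ : ℤˣ), (∀ r ∈ Finset.range 6,
      (if r % 2 = 0 then 1 else -1) * kron12 (m₂ + 4 * r) = σ * kron12 (c + 2 * r)) →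
      ∀ n : ℤ, (-1 : ℂ) ^ n * kron12 (m₂ + 4 * n) = ((σ * kron12 (c + 2 * n) : ℤ) : ℂ) := by
    intro m₂ c σ h n
    obtain ⟨r, hr⟩ : ∃ r : ℕ, (r : ℤ) = n % 6 := ⟨_, Int.toNat_of_nonneg (by omega)⟩
    have h1 : kron12 (m₂ + 4 * n) = kron12 (m₂ + 4 * r) := by
      simp only [kron12, show (m₂ + 4 * n) % 12 = (m₂ + 4 * r) % 12 by omega]
    have h2 : kron12 (c + 2 * n) = kron12 (c + 2 * r) := by
      simp only [kron12, show (c + 2 * n) % 12 = (c + 2 * r) % 12 by omega]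
    have h3 : (n % 2 = 0) ↔ (r % 2 = 0) := by omega
    rw [h1, h2, ← h r (Finset.mem_range.mpr (by omega)), neg_one_zpow_eq]
    simp only [h3]
    push_cast
    rfl
  fin_cases k
  · refine ⟨2 * p + 1, 5, 1, -1, ?_, ?_, ?_, ?_, key _ _ _ (by decide)⟩
    · simp [vecM]
    · simp [ell]; ring
    · decide
    · decide
  · refine ⟨1, 1, -1, 1, ?_, ?_, ?_, ?_, key _ _ _ (by decide)⟩
    · simp [vecM]
    · simp [ell]
    · decide
    · decide
  · refine ⟨2 * p + 3, 3, 3, -1, ?_, ?_, ?_, ?_, key _ _ _ (by decide)⟩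
    · simp [vecM]
    · simp [ell]; ring
    · decide
    · decide
  · refine ⟨2 * p + 1, 1, -1, 1, ?_, ?_, ?_, ?_, key _ _ _ (by decide)⟩
    · simp [vecM]
    · simp [ell]; ring
    · decide
    · decide
  · refine ⟨1, 3, -3, 1, ?_, ?_, ?_, ?_, key _ _ _ (by decide)⟩
    · simp [vecM]
    · simp [ell]; ring
    · decide
    · decide

/-! ### The false theta function of rank two -/

/-- The terms `(-1) ^ (x₁ + x₂) sgn (B(x + μ, c₁)) q ^ Q(x + μ)`, `x ∈ ℤ²`, of the alternating sum
of the four false theta functions attached to `μ + ε`, `ε ∈ {0, 1}²`. -/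
noncomputable def latticeTerm (p : ℕ) (μ : Fin 2 → ℝ) (τ : ℂ) (x : ℤ × ℤ) : ℂ :=
  (-1 : ℂ) ^ (x.1 + x.2) *
    (((Real.sign (bilin (matA p) ![x.1 + μ 0, x.2 + μ 1] (vecC1 p)) : ℝ) : ℂ) *
      qPow (quad (matA p) ![x.1 + μ 0, x.2 + μ 1]) τ)

theorem summable_latticeTerm {p : ℕ} (hp : 1 ≤ p) (μ : Fin 2 → ℝ) {τ : ℂ} (hτ : 0 < τ.im) :
    Summable (latticeTerm p μ τ) := by
  have hp' : (1 : ℝ) ≤ p := by exact_mod_cast hp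
  have ha : 0 < Real.pi * τ.im := mul_pos Real.pi_pos hτ
  refine .of_norm_bounded ((summable_exp_neg_mul_sq ha (μ 0)).mul_of_nonneg
    (summable_exp_neg_mul_sq ha (μ 1)) (fun _ => (Real.exp_pos _).le)
    (fun _ => (Real.exp_pos _).le)) fun x => ?_
  rw [latticeTerm, norm_mul, norm_mul, norm_zpow, norm_neg, norm_one, one_zpow, one_mul, norm_qPow,
    ← Real.exp_add, Complex.norm_real, quad_matA]
  refine (mul_le_of_le_one_left (Real.exp_pos _).le ?_).trans (Real.exp_le_exp.mpr ?_)
  · rcases Real.sign_apply_eq (bilin (matA p) ![x.1 + μ 0, x.2 + μ 1] (vecC1 p)) with h | h | h <;>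
      simp [h]
  · simp only [Matrix.cons_val]
    generalize (x.1 : ℝ) + μ 0 = u
    generalize (x.2 : ℝ) + μ 1 = v
    -- `2 Q(u, v) - u² - v² = 2 (u + v)² + 2 (p - 1) u²`
    have h : 0 ≤ 2 * (u + v) ^ 2 + 2 * (p - 1) * u ^ 2 := by
      have : 0 ≤ (p : ℝ) - 1 := by linarith
      positivity
    nlinarith [mul_nonneg ha.le h]

theorem sum_falseTheta2_eq {p : ℕ} (hp : 1 ≤ p) (μ : Fin 2 → ℝ) {τ : ℂ} (hτ : 0 < τ.im) :
    ∑ ε₁ ∈ Finset.range 2, ∑ ε₂ ∈ Finset.range 2, (-1 : ℂ) ^ (ε₁ + ε₂) *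
      falseTheta2 (matA p) (μ + ![(ε₁ : ℝ), (ε₂ : ℝ)]) (vecC1 p) τ =
    ∑' x, latticeTerm p μ τ x := by
  rw [← sum_parity_tsum_eq (summable_latticeTerm hp μ hτ)]
  refine Finset.sum_congr rfl fun i _ => Finset.sum_congr rfl fun j _ => ?_
  rw [falseTheta2, ← tsum_mul_left]
  refine tsum_congr fun n => ?_
  have hx : (fun k => 2 * (n k : ℝ) + (μ + ![(i : ℝ), (j : ℝ)]) k) =
      ![((2 * n 0 + i : ℤ) : ℝ) + μ 0, ((2 * n 1 + j : ℤ) : ℝ) + μ 1] := by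
    ext k
    fin_cases k <;> simp <;> ring
  have hz : (-1 : ℂ) ^ (i + j) = (-1 : ℂ) ^ (2 * n 0 + i + (2 * n 1 + j)) := by
    rw [← zpow_natCast, neg_one_zpow_eq, neg_one_zpow_eq]
    push_cast
    congr 2
    omega
  rw [latticeTerm, hx, hz]

theorem latticeTerm_vecMu {p : ℕ} (hp : 1 ≤ p) {k : Fin 5} {m₁ m₂ : ℤ}
    (hm : vecM p k = ![(m₁ : ℝ), (m₂ : ℝ)]) (τ : ℂ) (x : ℤ × ℤ) :
    latticeTerm p (vecMu p k) τ x =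
      (-1 : ℂ) ^ x.1 *
        falseTerm ((6 * p - 1 : ℤ) : ℝ) τ (3 * m₁ - 2 * m₂ + 2 * x.1 * (6 * p - 1)) *
        ((-1 : ℂ) ^ x.2 * qPow (3 / 2 * ((x.2 : ℝ) + (m₂ + 4 * x.1 : ℤ) / 6) ^ 2) τ) := by
  have hp' : (1 : ℝ) ≤ p := by exact_mod_cast hp
  have hM : 0 < 6 * (p : ℝ) - 1 := by linarith
  have hM' : 6 * (p : ℝ) - 1 ≠ 0 := hM.ne'
  set r : ℤ := 3 * m₁ - 2 * m₂ + 2 * x.1 * (6 * p - 1) with hr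
  have h0 : (x.1 : ℝ) + vecMu p k 0 = r / (2 * (6 * p - 1)) := by
    rw [vecMu_eq hp hm, hr]
    simp only [Matrix.cons_val]
    push_cast
    field_simp
    ring
  have h1 : (x.2 : ℝ) + vecMu p k 1 + 2 / 3 * (x.1 + vecMu p k 0) =
      x.2 + (m₂ + 4 * x.1 : ℤ) / 6 := by
    have e : (-2 * m₁ + (2 * p + 1) * m₂) / (2 * (6 * (p : ℝ) - 1)) +
        2 / 3 * ((3 * m₁ - 2 * m₂) / (2 * (6 * p - 1))) = (m₂ : ℝ) / 6 := by
      rw [mul_div_assoc', ← add_div, div_eq_iff (mul_ne_zero two_ne_zero hM')]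
      ring
    rw [vecMu_eq hp hm]
    simp only [Matrix.cons_val]
    push_cast
    linear_combination e
  have hs : Real.sign ((r : ℝ) / (2 * (6 * p - 1))) = (r.sign : ℝ) := by
    rcases lt_trichotomy r 0 with h | h | h
    · rw [Int.sign_eq_neg_one_of_neg h, Real.sign_of_neg]
      · norm_num
      · exact div_neg_of_neg_of_pos (by exact_mod_cast h) (by linarith)
    · simp [h]
    · rw [Int.sign_eq_one_of_pos h, Real.sign_of_pos]
      · norm_num
      · exact div_pos (by exact_mod_cast h) (by linarith)
  have hq : (6 * (p : ℝ) - 1) / 6 * (r / (2 * (6 * p - 1))) ^ 2 =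
      (r : ℝ) ^ 2 / (24 * ((6 * p - 1 : ℤ) : ℝ)) := by
    push_cast
    field_simp
    ring
  rw [latticeTerm, sign_bilin_vecC1 hp, quad_matA, falseTerm]
  simp only [Matrix.cons_val]
  rw [h1, h0, hs, hq, qPow_add, zpow_add₀ (by norm_num)]
  push_cast
  ring

/-- The `c₁`-part is a multiple of the partial theta function in the whole upper half plane: summing
over the second coordinate first produces the factor `η`. -/
theorem c1Half_eq {p : ℕ} (hp : 1 ≤ p) (k : Fin 5) {τ : ℂ} (hτ : 0 < τ.im) :
    c1Half p k τ = -(1 / 2) *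
      (prefactor p k τ * Phi ![2, 3, 6 * (p : ℤ) - 1] ![1, 1, ell p k] τ) := by
  obtain ⟨m₁, m₂, c, σ, hm, ha, hm₂, hc, hk⟩ := exists_family_data p k
  have heta : ModularForm.eta τ ≠ 0 := ModularForm.eta_ne_zero hτ
  have hsum : ∑' x, latticeTerm p (vecMu p k) τ x =
      -(ModularForm.eta τ * Phi ![2, 3, 6 * (p : ℤ) - 1] ![1, 1, ell p k] τ) := by
    rw [(summable_latticeTerm hp _ hτ).tsum_prod, Phi_eq_tsum (by omega) σ hc hτ, mul_neg, neg_neg,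
      ← tsum_mul_left]
    refine tsum_congr fun n => ?_
    simp only [latticeTerm_vecMu hp hm]
    rw [tsum_mul_left, tsum_neg_one_zpow_mul_qPow hτ (hm₂.add_even ⟨2 * n, by ring⟩), ← hk n, ha]
    rw [show c * (6 * (p : ℤ) - 1) + 6 * σ * ell p k + 2 * n * (6 * p - 1) =
      (c + 2 * n) * (6 * p - 1) + 6 * σ * ell p k by ring]
    ring
  rw [c1Half, sum_falseTheta2_eq hp _ hτ, hsum]
  field_simp

end FalseTheta

theorem theorem3p14 (p : ℕ) (hp : 1 ≤ p) (N : ℕ) (hN : 1 ≤ N) (k : Fin 5) :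
    ∃ l : ℂ,
      Filter.Tendsto
        (fun t : ℝ => FalseTheta.prefactor p k (FalseTheta.vert N t) *
          FalseTheta.Phi ![2, 3, 6 * (p : ℤ) - 1] ![1, 1, FalseTheta.ell p k]
            (FalseTheta.vert N t))
        (nhdsWithin 0 (Set.Ioi 0)) (nhds l) ∧
      Filter.Tendsto
        (fun t : ℝ => FalseTheta.c1Half p k (FalseTheta.vert N t))
        (nhdsWithin 0 (Set.Ioi 0)) (nhds (-(1 / 2) * l)) := by
  obtain ⟨l, hl⟩ := FalseTheta.exists_tendsto_Phi (p := ![2, 3, 6 * (p : ℤ) - 1])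
    (ℓ := ![1, 1, FalseTheta.ell p k]) (by simp only [Matrix.cons_val]; omega) hN
  have hpre : Continuous fun t : ℝ => FalseTheta.prefactor p k (FalseTheta.vert N t) := by
    unfold FalseTheta.prefactor FalseTheta.qPow FalseTheta.vert
    fun_prop
  have hlim := ((hpre.tendsto 0).mono_left (nhdsWithin_le_nhds (s := Set.Ioi 0))).mul hl
  refine ⟨_, hlim, (hlim.const_mul (-(1 / 2))).congr' ?_⟩
  filter_upwards [self_mem_nhdsWithin] with t ht
  refine (FalseTheta.c1Half_eq hp k ?_).symm
  have hre : (1 / (N : ℂ)).im = 0 := by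
    rw [show (1 / (N : ℂ)) = ((1 / N : ℝ) : ℂ) by push_cast; rfl, Complex.ofReal_im]
  simpa [FalseTheta.vert, hre] using ht
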